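/- A \emph{loop} is a set $L$ with a binary operation $\cdot$, an element $1$ with $1\cdot y=y\cdot 1=y$ for all $y$, and left and right divisions $\backslash,/$ satisfying $x\cdot(x\backslash y)=x\backslash(x\cdot y)=(y/x)\cdot x=(y\cdot x)/x=y$ for all $x,y\in L$. For $x\in L$ let $L(x)$ and $R(x)$ be the permutations of $L$, acting on the right, given by $yL(x)=xy$ and $yR(x)=yx$. An \emph{ARIF loop} is a loop that is flexible, i.e. $x(yx)=(xy)x$ for all $x,y$ (so that $xyx$ is unambiguous), and satisfies, for all $x,y\in L$, $$R(x)R(yxy)=R(xyx)R(y)\qquad\text{and}\qquad L(x)L(yxy)=L(xyx)L(y),$$ where products of permutations are composed from left to right; that is, $(zx)(yxy)=(z(xyx))y$ and $(yxy)(xz)=y((xyx)z)$ for all $x,y,z\in L$. \textbf{Theorem.} Every ARIF loop $L$ is \emph{diassociative}: for all $x,y\in L$, the subloop of $L$ generated by $x$ and $y$ (the smallest subset containing $x,y,1$ and closed under $\cdot$, $\backslash$ and $/$) is a group. -/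

import Mathlib

universe u

/-- A loop `(L; ·, \, /, 1)`: a set with a multiplication, left and right divisions
and a two-sided identity element. -/
class Loop (L : Type u) extends MulOneClass L where
  /-- `ldiv x y` is the left quotient `x \ y`. -/
  ldiv : L → L → L
  /-- `rdiv y x` is the right quotient `y / x`. -/
  rdiv : L → L → L
  mul_ldiv : ∀ x y : L, x * ldiv x y = y
  ldiv_mul : ∀ x y : L, ldiv x (x * y) = y
  rdiv_mul : ∀ x y : L, rdiv y x * x = y
  mul_rdiv : ∀ x y : L, rdiv (y * x) x = y

namespace Loop

/-- The left translation `y ↦ x * y`. -/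
def leftTrans {L : Type u} [Loop L] (x : L) : Equiv.Perm L where
  toFun y := x * y
  invFun y := ldiv x y
  left_inv y := ldiv_mul x y
  right_inv y := mul_ldiv x y

/-- The right translation `y ↦ y * x`. -/
def rightTrans {L : Type u} [Loop L] (x : L) : Equiv.Perm L where
  toFun y := y * x
  invFun y := rdiv y x
  left_inv y := mul_rdiv x y
  right_inv y := rdiv_mul x y

/-- The flexible law. -/
def IsFlexible (L : Type u) [Loop L] : Prop :=
  ∀ x y : L, x * (y * x) = (x * y) * x

/-- ARIF loops. Permutations act on the right, so a product of translations applies its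
left factor first; this is `Equiv.trans`. -/
structure IsARIF (L : Type u) [Loop L] : Prop where
  flexible : IsFlexible L
  w1 : ∀ x y : L, (rightTrans x).trans (rightTrans ((y * x) * y)) =
    (rightTrans ((x * y) * x)).trans (rightTrans y)
  w2 : ∀ x y : L, (leftTrans x).trans (leftTrans ((y * x) * y)) =
    (leftTrans ((x * y) * x)).trans (leftTrans y)

/-- A loop is a group if its multiplication and identity are those of some group structure
on the same set. -/
def IsGroup (L : Type u) [inst : Loop L] : Prop :=
  ∃ G : Group L, G.toDivInvMonoid.toMonoid.toMulOneClass = inst.toMulOneClass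

end Loop

/-- A subloop: a subset containing `1` and closed under multiplication and both divisions. -/
structure Subloop (L : Type u) [Loop L] where
  carrier : Set L
  one_mem : 1 ∈ carrier
  mul_mem : ∀ {a b : L}, a ∈ carrier → b ∈ carrier → a * b ∈ carrier
  ldiv_mem : ∀ {a b : L}, a ∈ carrier → b ∈ carrier → Loop.ldiv a b ∈ carrier
  rdiv_mem : ∀ {a b : L}, a ∈ carrier → b ∈ carrier → Loop.rdiv a b ∈ carrier

namespace Subloop

/-- A subloop is a loop under the restricted operations. -/
instance instLoop {L : Type u} [Loop L] (H : Subloop L) : Loop H.carrier where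
  mul a b := ⟨a.1 * b.1, H.mul_mem a.2 b.2⟩
  one := ⟨1, H.one_mem⟩
  one_mul a := Subtype.ext (one_mul a.1)
  mul_one a := Subtype.ext (mul_one a.1)
  ldiv a b := ⟨Loop.ldiv a.1 b.1, H.ldiv_mem a.2 b.2⟩
  rdiv a b := ⟨Loop.rdiv a.1 b.1, H.rdiv_mem a.2 b.2⟩
  mul_ldiv a b := Subtype.ext (Loop.mul_ldiv a.1 b.1)
  ldiv_mul a b := Subtype.ext (Loop.ldiv_mul a.1 b.1)
  rdiv_mul a b := Subtype.ext (Loop.rdiv_mul a.1 b.1)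
  mul_rdiv a b := Subtype.ext (Loop.mul_rdiv a.1 b.1)

/-- The subloop generated by a set: the intersection of all subloops containing it. -/
def closure {L : Type u} [Loop L] (S : Set L) : Subloop L where
  carrier := {a | ∀ H : Subloop L, S ⊆ H.carrier → a ∈ H.carrier}
  one_mem H _ := H.one_mem
  mul_mem ha hb H hH := H.mul_mem (ha H hH) (hb H hH)
  ldiv_mem ha hb H hH := H.ldiv_mem (ha H hH) (hb H hH)
  rdiv_mem ha hb H hH := H.rdiv_mem (ha H hH) (hb H hH)

end Subloop

/-- A loop is diassociative if the subloop generated by any two elements is a group. -/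
def Loop.IsDiassociative (L : Type u) [Loop L] : Prop :=
  ∀ x y : L, Loop.IsGroup (Subloop.closure ({x, y} : Set L)).carrier

namespace Loop

/-! ### The inverse property and powers -/

/-! The two ARIF laws give the inverse property and well-behaved powers. Their main use is for
progressions, such as `x ^ k * b`: if `X` is a progression, right translation by `X (k + 2)` differs
from that by `X k` by a permutation independent of `k`, on whichever side it is composed. Hence one
coincidence `z * X i = w * X j` propagates to all shifts of both indices by the same even number
(`shift_right`), and `shift_left` is the companion for a fixed even gap.

Diassociativity is then proved by induction on word size. Words alternate powers of the two
generators, with zero exponents allowed, and `AssocUpTo` says that `r⁻¹ x ^ i s` times `s⁻¹ x ^ j t`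
is `r⁻¹ x ^ (i + j) t`. When an exponent vanishes, neighbouring letters merge and the size drops;
even shifts then supply most other exponents. What remains at each size is to associate a single odd
power of `x` with the words on its two sides (`AssocUpTo.succ`).

From size four on, a split can be moved across two letters (`shift_two`), which carries it to a word
`x ^ a * (y * w)` where all inner exponents of `w` are `1`. Such a `w` is a power of `x * y` times a
simple factor, so progressions apply again (`ones`). Products of four letters need a separate
argument by parity. -/

instance instInv {L : Type u} [Loop L] : Inv L := ⟨fun x => ldiv x 1⟩

/-- Integer powers, as iterated right translations of `1`. -/
instance instPowInt {L : Type u} [Loop L] : Pow L ℤ := ⟨fun x n => (rightTrans x ^ n) 1⟩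

section Basic

variable {L : Type u} [Loop L]

theorem mul_left_inj' {x y z : L} (h : y * x = z * x) : y = z := by
  rw [← mul_rdiv x y, h, mul_rdiv]

theorem mul_right_inj' {x y z : L} (h : x * y = x * z) : y = z := by
  rw [← ldiv_mul x y, h, ldiv_mul]

@[simp] theorem rightTrans_apply (x y : L) : rightTrans x y = y * x := rfl

theorem zpow_def (x : L) (n : ℤ) : x ^ n = (rightTrans x ^ n) 1 := rfl

@[simp] theorem zpow_zero (x : L) : x ^ (0 : ℤ) = 1 := rfl

@[simp] theorem zpow_one (x : L) : x ^ (1 : ℤ) = x := by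
  simp [zpow_def]

@[simp] theorem mul_inv_self (x : L) : x * x⁻¹ = 1 := mul_ldiv x 1

variable [hL : Fact (IsARIF L)]

theorem flex (x y : L) : x * (y * x) = (x * y) * x := hL.out.flexible x y

theorem mul_mul_sandwich (x y z : L) :
    (z * x) * ((y * x) * y) = (z * ((x * y) * x)) * y :=
  Equiv.congr_fun (hL.out.w1 x y) z

theorem sandwich_mul_mul (x y z : L) :
    ((y * x) * y) * (x * z) = y * (((x * y) * x) * z) :=
  Equiv.congr_fun (hL.out.w2 x y) z

@[simp] theorem inv_mul_cancel_left (x u : L) : x⁻¹ * (x * u) = u := by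
  have key : ∀ u : L, rdiv 1 x * (x * u) = u := by
    intro u
    -- With `z = 1 / x` the factor `z * x` disappears, and `y = u / x` can be cancelled on the
    -- right.
    have h := mul_mul_sandwich x (rdiv u x) (rdiv 1 x)
    rw [rdiv_mul, one_mul] at h
    have h' := mul_left_inj' h
    rw [← flex, rdiv_mul] at h'
    exact h'.symm
  have h : x⁻¹ = rdiv 1 x := by
    have := key x⁻¹
    rw [mul_inv_self, mul_one] at this
    exact this.symm
  rw [h, key]

@[simp] theorem mul_inv_cancel_right (x u : L) : (u * x) * x⁻¹ = u := by
  have h := sandwich_mul_mul x (ldiv x u) x⁻¹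
  rw [mul_inv_self, mul_one, ← flex] at h
  have h' := mul_right_inj' h
  rw [mul_ldiv] at h'
  exact h'.symm

@[simp] theorem inv_mul_self (x : L) : x⁻¹ * x = 1 := by
  simpa using inv_mul_cancel_left x 1

@[simp] theorem inv_inv (x : L) : x⁻¹⁻¹ = x := by
  simpa using inv_mul_cancel_left x⁻¹ x

@[simp] theorem mul_inv_cancel_left (x u : L) : x * (x⁻¹ * u) = u := by
  simpa using inv_mul_cancel_left x⁻¹ u

@[simp] theorem inv_mul_cancel_right (x u : L) : (u * x⁻¹) * x = u := by
  simpa using mul_inv_cancel_right x⁻¹ u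

@[simp] theorem mul_inv_rev (x y : L) : (x * y)⁻¹ = y⁻¹ * x⁻¹ := by
  have h := inv_mul_cancel_left (x * y) y⁻¹
  rw [mul_inv_cancel_right] at h
  rw [← h, mul_inv_cancel_right]

@[simp] theorem inv_one : (1 : L)⁻¹ = 1 := by
  simpa using inv_mul_self (1 : L)

theorem eq_inv_mul {x y z : L} (h : x * y = z) : y = x⁻¹ * z := by
  rw [← h, inv_mul_cancel_left]

theorem eq_mul_inv {x y z : L} (h : x * y = z) : x = z * y⁻¹ := by
  rw [← h, mul_inv_cancel_right]

theorem inv_injective {x y : L} (h : x⁻¹ = y⁻¹) : x = y := by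
  rw [← inv_inv x, h, inv_inv]

theorem ldiv_eq (x y : L) : ldiv x y = x⁻¹ * y := eq_inv_mul (mul_ldiv x y)

theorem rdiv_eq (x y : L) : rdiv x y = x * y⁻¹ := eq_mul_inv (rdiv_mul y x)

theorem rightTrans_inv (x : L) : rightTrans x⁻¹ = (rightTrans x)⁻¹ := by
  refine (inv_eq_of_mul_eq_one_right ?_).symm
  ext y
  simp

theorem rightTrans_sandwich (x y : L) :
    rightTrans ((y * x) * y) * rightTrans x = rightTrans y * rightTrans ((x * y) * x) :=
  hL.out.w1 x y

theorem rightTrans_natPow (x : L) (n : ℕ) :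
    rightTrans ((rightTrans x ^ n) 1) = rightTrans x ^ n := by
  induction n using Nat.strong_induction_on with
  | _ n ih =>
  rcases n with _ | _ | k
  · ext y; simp
  · simp
  · set p : L := (rightTrans x ^ k) 1 with hp
    set q : L := (rightTrans x ^ (k + 1)) 1 with hq
    have hP : rightTrans p = rightTrans x ^ k := ih k (by omega)
    have hQ : rightTrans q = rightTrans x ^ (k + 1) := ih (k + 1) (by omega)
    have hP' : rightTrans p⁻¹ = (rightTrans x ^ k)⁻¹ := by rw [rightTrans_inv, hP]
    have e1 : p⁻¹ * q = x := by
      have h1 : p * x = q := by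
        rw [hp, hq, pow_succ', Equiv.Perm.mul_apply, rightTrans_apply]
      rw [← h1, inv_mul_cancel_left]
    have e2 : q * p⁻¹ = x := by
      have h2 : q * p⁻¹ = rightTrans p⁻¹ q := rfl
      rw [h2, hP', hq, ← Equiv.Perm.mul_apply, pow_succ, _root_.inv_mul_cancel_left]
      simp
    -- For `p = x ^ k` and `q = x ^ (k + 1)` both `p⁻¹ * q` and `q * p⁻¹` are `x`, so the law
    -- expresses the translation by `x * q = x ^ (k + 2)` through lower powers.
    have h := rightTrans_sandwich p⁻¹ q
    rw [e1, e2] at h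
    have e4 : x * q = (rightTrans x ^ (k + 2)) 1 := by
      have h2 : x * q = rightTrans q x := rfl
      have h3 : x = rightTrans x 1 := by simp
      rw [h2, hQ]
      nth_rewrite 2 [h3]
      rw [← Equiv.Perm.mul_apply, ← pow_succ]
    have e5 : rightTrans (x * p⁻¹) = rightTrans x * (rightTrans x ^ k)⁻¹ := by
      rcases k with _ | k
      · have : p = 1 := by simp [hp]
        rw [this]; simp
      · have hR : rightTrans ((rightTrans x ^ k) 1) = rightTrans x ^ k := ih k (by omega)
        have h6 : x * p⁻¹ = ((rightTrans x ^ k) 1)⁻¹ := by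
          have h7 : p = (rightTrans x ^ k) 1 * x := by
            rw [hp, pow_succ', Equiv.Perm.mul_apply, rightTrans_apply]
          rw [h7, mul_inv_rev, mul_inv_cancel_left]
        rw [h6, rightTrans_inv, hR]
        group
    rw [e4, hP', hQ, e5] at h
    rw [eq_mul_inv_of_mul_eq h]
    group

@[simp] theorem inv_zpow (x : L) (n : ℤ) : (x ^ n)⁻¹ = x ^ (-n) := by
  have nat : ∀ m : ℕ, (x ^ (m : ℤ))⁻¹ = x ^ (-(m : ℤ)) := by
    intro m
    have h := rightTrans_natPow x m
    have h2 := congrArg (fun f : Equiv.Perm L => f⁻¹ 1) h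
    rw [← rightTrans_inv] at h2
    simpa [zpow_def] using h2
  rcases Int.eq_nat_or_neg n with ⟨m, rfl | rfl⟩
  · exact nat m
  · rw [← nat m, inv_inv, neg_neg]

theorem rightTrans_zpow (x : L) (n : ℤ) : rightTrans (x ^ n) = rightTrans x ^ n := by
  rcases Int.eq_nat_or_neg n with ⟨m, rfl | rfl⟩
  · simpa [zpow_def] using rightTrans_natPow x m
  · rw [← inv_zpow, rightTrans_inv]
    have := rightTrans_natPow x m
    rw [zpow_neg, zpow_natCast, ← this]
    simp [zpow_def]

@[simp] theorem mul_zpow_mul_zpow (z x : L) (m n : ℤ) : (z * x ^ m) * x ^ n = z * x ^ (m + n) := by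
  have h : ∀ k : ℤ, z * x ^ k = (rightTrans x ^ k) z := by
    intro k; rw [← rightTrans_zpow]; rfl
  have h' : (z * x ^ m) * x ^ n = (rightTrans x ^ n) (z * x ^ m) := by
    rw [← rightTrans_zpow]; rfl
  rw [h', h, h, ← Equiv.Perm.mul_apply, ← zpow_add, add_comm]

@[simp] theorem zpow_mul_zpow (x : L) (m n : ℤ) : x ^ m * x ^ n = x ^ (m + n) := by
  simpa using mul_zpow_mul_zpow 1 x m n

@[simp] theorem zpow_mul_zpow_mul (x z : L) (m n : ℤ) : x ^ m * (x ^ n * z) = x ^ (m + n) * z := by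
  apply inv_injective
  simp [add_comm]

@[simp] theorem zpow_neg_one' (x : L) : x ^ (-1 : ℤ) = x⁻¹ := by
  rw [← inv_zpow, zpow_one]

theorem mul_mul_zpow (z x : L) (n : ℤ) : (z * x) * x ^ n = z * x ^ (1 + n) := by
  simpa using mul_zpow_mul_zpow z x 1 n

theorem mul_zpow_mul (z x : L) (n : ℤ) : (z * x ^ n) * x = z * x ^ (n + 1) := by
  simpa using mul_zpow_mul_zpow z x n 1

theorem zpow_mul_mul (z x : L) (n : ℤ) : x ^ n * (x * z) = x ^ (n + 1) * z := by
  simpa using zpow_mul_zpow_mul x z n 1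

theorem mul_zpow_mul' (z x : L) (n : ℤ) : x * (x ^ n * z) = x ^ (1 + n) * z := by
  simpa using zpow_mul_zpow_mul x z 1 n

/-- Left and right multiplications by powers of the same element commute. -/
theorem zpow_flex (x z : L) (m n : ℤ) : x ^ m * (z * x ^ n) = (x ^ m * z) * x ^ n := by
  have hl : ∀ k : ℤ, ∀ z : L, x ^ k * z = (leftTrans x ^ k) z := by
    intro k
    induction k using Int.induction_on with
    | zero => simp
    | succ k ih =>
      intro z
      rw [_root_.zpow_add, _root_.zpow_one, Equiv.Perm.mul_apply, ← ih, ← zpow_mul_mul]; rfl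
    | pred k ih =>
      intro z
      have h : z = x * (x⁻¹ * z) := by simp
      rw [sub_eq_add_neg, _root_.zpow_add, _root_.zpow_neg_one, Equiv.Perm.mul_apply, ← ih]
      have h2 : (leftTrans x)⁻¹ z = x⁻¹ * z := ldiv_eq x z
      rw [h2]
      nth_rewrite 1 [h]
      rw [zpow_mul_mul]; congr 2; ring
  have hc : Commute (leftTrans x) (rightTrans x) := by
    refine Equiv.ext fun z => ?_
    exact flex x z
  have h := congrArg (fun f : Equiv.Perm L => f z) ((hc.zpow_zpow m n).eq)
  simp only [Equiv.Perm.mul_apply, ← hl, ← rightTrans_zpow, rightTrans_apply] at h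
  exact h

end Basic

end Loop

/-! ### Progressions and their even shifts. -/

namespace Loop

section Progression

variable {L : Type u} [Loop L]

/-- A two-sided sequence in which each term is obtained from the two preceding ones as in
`k ↦ x ^ k * b`. -/
def IsProgression (X : ℤ → L) : Prop :=
  ∀ k, (X (k + 1) * (X k)⁻¹) * X (k + 1) = X (k + 2)

variable [hL : Fact (IsARIF L)]

theorem isProgression_zpow_mul (x b : L) : IsProgression fun k : ℤ => x ^ k * b := by
  intro k
  have h : (x ^ (k + 1) * b) * (x ^ k * b)⁻¹ = x := by
    have h1 : (x ^ k * b)⁻¹ = (x ^ (k + 1) * b)⁻¹ * x := by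
      simp [mul_zpow_mul]
    rw [h1, mul_inv_cancel_left]
  simp only [h]
  rw [mul_zpow_mul']
  congr 2; ring

theorem isProgression_mul_zpow (a x : L) : IsProgression fun k : ℤ => a * x ^ k := by
  intro k
  have h : (a * x ^ k)⁻¹ * (a * x ^ (k + 1)) = x := by
    have h1 : (a * x ^ (k + 1)) = (a * x ^ k) * x := by rw [mul_zpow_mul]
    rw [h1, inv_mul_cancel_left]
  simp only [← flex, h]
  rw [mul_zpow_mul]
  congr 2; ring

namespace IsProgression

variable {X : ℤ → L}

theorem backward (hX : IsProgression X) (k : ℤ) :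
    (X (k + 1) * (X (k + 2))⁻¹) * X (k + 1) = X k := by
  apply inv_injective
  rw [← hX k]
  simp

theorem ext {Y : ℤ → L} (hX : IsProgression X) (hY : IsProgression Y) (h0 : X 0 = Y 0)
    (h1 : X 1 = Y 1) (k : ℤ) : X k = Y k := by
  suffices h : X k = Y k ∧ X (k + 1) = Y (k + 1) from h.1
  induction k using Int.induction_on with
  | zero => exact ⟨h0, h1⟩
  | succ k ih =>
    refine ⟨ih.2, ?_⟩
    have := hX k
    rw [ih.1, ih.2, hY k] at this
    rw [add_assoc]; exact this.symm
  | pred k ih =>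
    have e1 : (-(k : ℤ) - 1) + 1 = -k := by ring
    have e2 : (-(k : ℤ) - 1) + 2 = -k + 1 := by ring
    refine ⟨?_, by rw [e1]; exact ih.1⟩
    have hx := hX.backward (-(k : ℤ) - 1)
    have hy := hY.backward (-(k : ℤ) - 1)
    rw [e1, e2] at hx hy
    rw [← hx, ← hy, ih.1, ih.2]

/-- This is the ARIF law at `(X (k + 1))⁻¹` and `X (k + 2)`: the two sandwiches are `X (k + 3)` and
`(X k)⁻¹`. -/
theorem rightTrans_mul_inv (hX : IsProgression X) (k : ℤ) :
    rightTrans (X (k + 3)) * (rightTrans (X (k + 1)))⁻¹ =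
      rightTrans (X (k + 2)) * (rightTrans (X k))⁻¹ := by
  have h := rightTrans_sandwich (X (k + 1))⁻¹ (X (k + 2))
  have e1 := hX (k + 1)
  rw [show k + 1 + 1 = k + 2 by ring, show k + 1 + 2 = k + 3 by ring] at e1
  have e2 : ((X (k + 1))⁻¹ * X (k + 2)) * (X (k + 1))⁻¹ = (X k)⁻¹ := by
    rw [← hX.backward k]; simp [flex]
  rw [e1, e2, rightTrans_inv, rightTrans_inv] at h
  exact h

theorem inv_mul_rightTrans (hX : IsProgression X) (k : ℤ) :
    (rightTrans (X (k + 1)))⁻¹ * rightTrans (X (k + 3)) =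
      (rightTrans (X k))⁻¹ * rightTrans (X (k + 2)) := by
  have h := rightTrans_sandwich (X (k + 2)) (X (k + 1))⁻¹
  have e1 := hX (k + 1)
  rw [show k + 1 + 1 = k + 2 by ring, show k + 1 + 2 = k + 3 by ring] at e1
  have e2 : ((X (k + 1))⁻¹ * X (k + 2)) * (X (k + 1))⁻¹ = (X k)⁻¹ := by
    rw [← hX.backward k]; simp [flex]
  rw [e1, e2, rightTrans_inv, rightTrans_inv] at h
  exact h.symm

end IsProgression

/-- A sequence in a group with constant second-step left ratio. -/
theorem exists_zpow_mul_of_ratio {G : Type*} [Group G] (D : ℤ → G)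
    (h : ∀ k, D (k + 3) * (D (k + 1))⁻¹ = D (k + 2) * (D k)⁻¹) :
    ∃ c : G, ∀ k n : ℤ, D (k + 2 * n) = c ^ n * D k := by
  refine ⟨D 2 * (D 0)⁻¹, ?_⟩
  have h1 : ∀ k : ℤ, D (k + 2) * (D k)⁻¹ = D 2 * (D 0)⁻¹ := by
    intro k
    induction k using Int.induction_on with
    | zero => rw [zero_add]
    | succ k ih => rw [← ih, ← h k]; congr 2
    | pred k ih =>
      rw [← ih]
      have := h (-(k : ℤ) - 1)
      rw [show -(k : ℤ) - 1 + 3 = -k + 2 by ring, show -(k : ℤ) - 1 + 1 = -k by ring] at this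
      exact this.symm
  have h2 : ∀ k : ℤ, D (k + 2) = D 2 * (D 0)⁻¹ * D k := fun k => by
    rw [← h1 k]; group
  intro k n
  induction n using Int.induction_on with
  | zero => simp
  | succ n ih =>
    rw [mul_add, mul_one, ← add_assoc, h2, ih, add_comm (n : ℤ) 1, _root_.zpow_add,
      _root_.zpow_one, mul_assoc (D 2 * (D 0)⁻¹)]
  | pred n ih =>
    have := h2 (k + 2 * (-(n : ℤ) - 1))
    rw [show k + 2 * (-(n : ℤ) - 1) + 2 = k + 2 * -(n : ℤ) by ring, ih] at this
    rw [sub_eq_neg_add, _root_.zpow_add, _root_.zpow_neg_one, mul_assoc, this]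
    group

namespace IsProgression

variable {X : ℤ → L}

/-- Passing from `X k` to `X (k + 2 * n)` applies `c ^ n` after the translation, with `c`
independent of `k`, so equal products remain equal. -/
theorem shift_right (hX : IsProgression X) {z w : L} {i j : ℤ} (h : z * X i = w * X j) (n : ℤ) :
    z * X (i + 2 * n) = w * X (j + 2 * n) := by
  obtain ⟨c, hc⟩ := exists_zpow_mul_of_ratio (fun k => rightTrans (X k)) hX.rightTrans_mul_inv
  have hi := congrArg (fun f : Equiv.Perm L => f z) (hc i n)
  have hj := congrArg (fun f : Equiv.Perm L => f w) (hc j n)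
  simp only [Equiv.Perm.mul_apply, rightTrans_apply] at hi hj
  rw [hi, hj, h]

/-- Here the constant permutation acts before the translation: the hypothesis at one index
identifies `w` as the image of `z`, and this serves every index. -/
theorem shift_left (hX : IsProgression X) {z w : L} {i n : ℤ} (h : z * X (i + 2 * n) = w * X i)
    (j : ℤ) : z * X (j + 2 * n) = w * X j := by
  obtain ⟨c, hc⟩ := exists_zpow_mul_of_ratio (fun k => (rightTrans (X k))⁻¹) (by
    intro k
    simpa using congrArg (·⁻¹) (hX.inv_mul_rightTrans k))
  have key : ∀ k : ℤ, z * X (k + 2 * n) = (c ^ n)⁻¹ z * X k := by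
    intro k
    have hk := congrArg (fun f : Equiv.Perm L => f⁻¹ z) (hc k n)
    simpa using hk
  rw [key] at h ⊢
  rw [mul_left_inj' h]

end IsProgression

/-- Conjugation respects powers. -/
theorem conj_zpow (c x : L) (k : ℤ) : c⁻¹ * (x ^ k * c) = (c⁻¹ * (x * c)) ^ k := by
  have h : x ^ k * c = c * (c⁻¹ * (x * c)) ^ k :=
    (isProgression_zpow_mul x c).ext (isProgression_mul_zpow c (c⁻¹ * (x * c)))
      (by simp) (by simp) k
  rw [h, inv_mul_cancel_left]

section Associating

variable {a b x : L}

theorem mul_zpow_mul_zpow_mul_even (h0 : ∀ p : ℤ, (a * x ^ (-p)) * (x ^ p * b) = a * b)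
    (i j n : ℤ) : (a * x ^ i) * (x ^ j * b) = (a * x ^ (i + 2 * n)) * (x ^ (j - 2 * n) * b) := by
  have e1 := h0 (-i)
  have e2 := h0 (-i - 2 * n)
  rw [neg_neg] at e1
  rw [show -(-i - 2 * n) = i + 2 * n by ring] at e2
  have h := (isProgression_zpow_mul x b).shift_left (z := a * x ^ i) (w := a * x ^ (i + 2 * n))
    (i := -i - 2 * n) (n := n) (by rw [sub_add_cancel, e1, e2]) (j - 2 * n)
  rwa [sub_add_cancel] at h

/-- If `a`, `x`, `b` associate after cancelling powers of `x`, and for a single odd power of `x`,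
then they associate for all powers of `x`. -/
theorem mul_zpow_mul_zpow_mul (h0 : ∀ p : ℤ, (a * x ^ (-p)) * (x ^ p * b) = a * b)
    {d : ℤ} (hd : Odd d) (h1 : a * (x ^ d * b) = (a * x ^ d) * b) (i j : ℤ) :
    (a * x ^ i) * (x ^ j * b) = a * (x ^ (i + j) * b) := by
  have hX := isProgression_zpow_mul x b
  rcases Int.even_or_odd i with hi | hi
  · obtain ⟨m, hm⟩ := hi
    rw [mul_zpow_mul_zpow_mul_even h0 i j (-m), hm]
    simp only [show m + m + 2 * -m = 0 by ring, show j - 2 * -m = m + m + j by ring, zpow_zero,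
      mul_one]
  -- Even `m` is reached from `m = 0`, given by `h1`; odd `m` from `m = -d`, given by `h0`.
  · have hd1 : ∀ m : ℤ, (a * x ^ d) * (x ^ m * b) = a * (x ^ (d + m) * b) := by
      intro m
      rcases Int.even_or_odd m with hm | hm
      · obtain ⟨n, hn⟩ := hm
        have := hX.shift_right (z := a * x ^ d) (w := a) (i := 0) (j := d) (by simp [h1]) n
        rw [hn, ← two_mul]; simpa using this
      · obtain ⟨n, hn⟩ := hm.add_odd hd
        have h2 := h0 (-d)
        rw [neg_neg] at h2
        have := hX.shift_right (z := a * x ^ d) (w := a) (i := -d) (j := 0) (by simp [h2]) n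
        rw [show -d + 2 * n = m by linarith, show 0 + 2 * n = d + m by linarith] at this
        exact this
    obtain ⟨n, hn⟩ := hd.sub_odd hi
    rw [mul_zpow_mul_zpow_mul_even h0 i j n, show i + 2 * n = d by linarith, hd1]
    congr 3; linarith

end Associating

theorem zpow_mul_zpow_mul_zpow (x y : L) (m i j n : ℤ) :
    (y ^ m * x ^ i) * (x ^ j * y ^ n) = y ^ m * (x ^ (i + j) * y ^ n) := by
  refine mul_zpow_mul_zpow_mul (fun p => ?_) odd_one (by rw [zpow_flex]) i j
  have h : x ^ p * y ^ n = (y ^ m * x ^ (-p))⁻¹ * (y ^ m * y ^ n) := by simp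
  rw [h, mul_inv_cancel_left]

end Progression

end Loop

/-! ### Alternating words and the induction on their size. -/

namespace Loop

section Words

variable {L : Type u} [Loop L]

/-- The right-nested product `x ^ e₁ * (y ^ e₂ * (x ^ e₃ * ⋯))`. -/
def ev (x y : L) : List ℤ → L
  | [] => 1
  | e :: l => x ^ e * ev y x l

@[simp] theorem ev_nil (x y : L) : ev x y [] = 1 := rfl

@[simp] theorem ev_cons (x y : L) (e : ℤ) (l : List ℤ) : ev x y (e :: l) = x ^ e * ev y x l := rfl

/-- The value of the word `r⁻¹ x ^ i s`, where `r` and `s` are words starting with `y`. -/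
def link (x y : L) (r : List ℤ) (i : ℤ) (s : List ℤ) : L :=
  (ev y x r)⁻¹ * (x ^ i * ev y x s)

/-- All products of words of total size at most `n` are computed as in a group. -/
def AssocUpTo (L : Type u) [Loop L] (n : ℕ) : Prop :=
  ∀ (x y : L) (r s t : List ℤ) (i j : ℤ), r.length + s.length + t.length + 1 ≤ n →
    link x y r i s * link x y s j t = link x y r (i + j) t

variable [hL : Fact (IsARIF L)] {n : ℕ}

namespace AssocUpTo

theorem core (h : AssocUpTo L n) (x y : L) (r t : List ℤ) (i j : ℤ)
    (hn : r.length + t.length + 1 ≤ n) :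
    ((ev y x r)⁻¹ * x ^ i) * (x ^ j * ev y x t) = (ev y x r)⁻¹ * (x ^ (i + j) * ev y x t) := by
  simpa [link] using h x y r [] t i j (by simpa using hn)

theorem core_zero (h : AssocUpTo L n) (x y : L) (r t : List ℤ) (i : ℤ)
    (hn : r.length + t.length + 1 ≤ n) :
    ((ev y x r)⁻¹ * x ^ i) * ev y x t = (ev y x r)⁻¹ * (x ^ i * ev y x t) := by
  simpa using h.core x y r t i 0 hn

theorem inv_link (h : AssocUpTo L n) (x y : L) (r s : List ℤ) (i : ℤ)
    (hn : r.length + s.length + 1 ≤ n) : (link x y r i s)⁻¹ = link x y s (-i) r := by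
  simpa [link] using h.core_zero x y s r (-i) (by omega)

theorem link_cons (h : AssocUpTo L n) (x y : L) (a : ℤ) (r s : List ℤ) (i : ℤ)
    (hn : r.length + s.length + 2 ≤ n) : link x y (a :: r) i s = link y x r (-a) (i :: s) := by
  simpa [link] using h.core_zero y x r (i :: s) (-a) (by simp; omega)

theorem link_cons_zero_cons (h : AssocUpTo L n) (x y : L) (a b : ℤ) (r s : List ℤ)
    (hn : r.length + s.length + 1 ≤ n) :
    link x y (a :: r) 0 (b :: s) = link y x r (-a + b) s := by
  simpa [link] using h.core y x r s (-a) b hn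

/-- With exponent `0` at the meeting point, the leading letters of `r` and `s` merge, so the product
becomes one of size at most `n` with the other generator as axis. -/
theorem zero_left (h : AssocUpTo L n) (x y : L) {r s : List ℤ} (hr : r ≠ []) (hs : s ≠ [])
    (t : List ℤ) (j : ℤ) (hn : r.length + s.length + t.length ≤ n) :
    link x y r 0 s * link x y s j t = link x y r j t := by
  obtain ⟨a, r, rfl⟩ := List.exists_cons_of_ne_nil hr
  obtain ⟨b, s, rfl⟩ := List.exists_cons_of_ne_nil hs
  simp only [List.length_cons] at hn
  rw [h.link_cons_zero_cons x y a b r s (by omega), h.link_cons x y b s t j (by omega),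
    h.link_cons x y a r t j (by omega), h y x r s (j :: t) _ _ (by simp; omega)]
  congr 1; ring

theorem zero_right (h : AssocUpTo L n) (x y : L) {r s t : List ℤ} (hr : r ≠ []) (hs : s ≠ [])
    (ht : t ≠ []) (i : ℤ) (hn : r.length + s.length + t.length ≤ n) :
    link x y r i s * link x y s 0 t = link x y r i t := by
  have l1 := List.length_pos_iff.2 hs
  have l2 := List.length_pos_iff.2 ht
  have l3 := List.length_pos_iff.2 hr
  apply inv_injective
  rw [mul_inv_rev, h.inv_link _ _ _ _ _ (by omega), h.inv_link _ _ _ _ _ (by omega),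
    h.inv_link _ _ _ _ _ (by omega), neg_zero, h.zero_left x y ht hs _ _ (by omega)]

/-- A word of three legs meeting on an axis, with the middle leg not longer than the first. -/
theorem three_legs_of_le (h : AssocUpTo L n) (x y : L) {r s t : List ℤ} (hr : r ≠ [])
    (hs : s ≠ []) (ht : t ≠ []) (hsr : s.length ≤ r.length)
    (hn : r.length + s.length + t.length ≤ n) (i j : ℤ) :
    link x y r i s * link x y s j t = link x y r (i + j) t := by
  have l1 := List.length_pos_iff.2 hr
  have l2 := List.length_pos_iff.2 hs
  have l3 := List.length_pos_iff.2 ht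
  have hX : IsProgression fun k : ℤ => link x y s k t := by
    have e : (fun k : ℤ => link x y s k t) =
        fun k : ℤ => ((ev y x s)⁻¹ * (x * ev y x s)) ^ k * link x y s 0 t := by
      funext k
      rw [← conj_zpow]
      -- The leg `s` occurs twice here, hence the need for `hsr`.
      exact (h.zero_right x y hs hs ht k (by omega)).symm
    rw [e]
    exact isProgression_zpow_mul _ _
  have h1 : ∀ l : ℤ, link x y r 0 s * link x y s l t = link x y r l t := fun l =>
    h.zero_left x y hr hs t l hn
  have h2 : ∀ k : ℤ, link x y r k s * link x y s 0 t = link x y r k t := fun k =>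
    h.zero_right x y hr hs ht k hn
  have h3 : ∀ k : ℤ, link x y r k s * link x y s (-k) t = link x y r 0 t := by
    intro k
    have := eq_mul_inv (h.zero_left x y hr ht s k (by omega))
    rw [this, h.inv_link x y t s k (by omega)]
  rw [← h1]
  -- At least one of `i`, `j`, `i + j` is even; the starting instances are `h1`, `h2` and `h3`
  -- respectively, each moved by an even shift.
  rcases Int.even_or_odd i with ⟨m, hm⟩ | hi
  · have := hX.shift_left (z := link x y r 0 s) (w := link x y r i s) (i := 0) (n := m)
      (by rw [h1, h2, hm]; congr 1; ring) j
    rw [show i + j = j + 2 * m by linarith]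
    exact this.symm
  rcases Int.even_or_odd j with ⟨m, hm⟩ | hj
  · have := hX.shift_right (z := link x y r i s) (w := link x y r 0 s) (i := 0) (j := i)
      (by rw [h1, h2]) m
    rw [show j = 0 + 2 * m by linarith, show i + (0 + 2 * m) = i + 2 * m by ring]
    exact this
  · obtain ⟨m, hm⟩ := hi.add_odd hj
    have := hX.shift_right (z := link x y r i s) (w := link x y r 0 s) (i := -i) (j := 0)
      (by rw [h1, h3]) m
    rw [show -i + 2 * m = j by linarith, show 0 + 2 * m = i + j by linarith] at this
    exact this

/-- If the middle leg is the longer one, exchanging `r` and `s` and solving by the inverse property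
gives the claim. -/
theorem three_legs (h : AssocUpTo L n) (x y : L) {r s t : List ℤ} (hr : r ≠ [])
    (hs : s ≠ []) (ht : t ≠ []) (hn : r.length + s.length + t.length ≤ n) (i j : ℤ) :
    link x y r i s * link x y s j t = link x y r (i + j) t := by
  rcases le_total s.length r.length with hsr | hsr
  · exact h.three_legs_of_le x y hr hs ht hsr hn i j
  · have l3 := List.length_pos_iff.2 ht
    have := h.three_legs_of_le x y hs hr ht hsr (by omega) (-i) (i + j)
    rw [neg_add_cancel_left] at this
    have e := h.inv_link x y s r (-i) (by omega)
    rw [neg_neg] at e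
    rw [← this, ← e, inv_mul_cancel_left]

/-- It is enough to associate one odd power of `x` with the words on both sides of it. -/
theorem core_of_odd (h : AssocUpTo L n) (x y : L) {r t : List ℤ} (hr : r ≠ []) (ht : t ≠ [])
    (hn : r.length + t.length = n) {d : ℤ} (hd : Odd d)
    (h1 : (ev y x r)⁻¹ * (x ^ d * ev y x t) = ((ev y x r)⁻¹ * x ^ d) * ev y x t) (i j : ℤ) :
    ((ev y x r)⁻¹ * x ^ i) * (x ^ j * ev y x t) = (ev y x r)⁻¹ * (x ^ (i + j) * ev y x t) := by
  refine mul_zpow_mul_zpow_mul (fun p => ?_) hd h1 i j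
  obtain ⟨a, r, rfl⟩ := List.exists_cons_of_ne_nil hr
  obtain ⟨b, t, rfl⟩ := List.exists_cons_of_ne_nil ht
  simp only [List.length_cons] at hn
  -- The axis is now `y`, with the power of `x` as the middle word.
  have e := h y x r [-p] t (-a) b (by simp; omega)
  have e' := h.core y x r t (-a) b (by omega)
  have e'' := h.core_zero y x r [-p] (-a) (by simp; omega)
  simp only [link, ev_cons, ev_nil, mul_one, inv_zpow, neg_neg, mul_inv_rev] at e e' e'' ⊢
  rw [e', ← e, e'']

/-- The induction step, reduced to associating one odd power of `x` with words on both sides. -/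
theorem succ (h : AssocUpTo L n)
    (h1 : ∀ (x y : L) (r t : List ℤ), r ≠ [] → t ≠ [] → r.length + t.length = n →
      ∃ d : ℤ, Odd d ∧
        (ev y x r)⁻¹ * (x ^ d * ev y x t) = ((ev y x r)⁻¹ * x ^ d) * ev y x t) :
    AssocUpTo L (n + 1) := by
  have hc : ∀ (x y : L) (r t : List ℤ) (i j : ℤ), r.length + t.length ≤ n →
      ((ev y x r)⁻¹ * x ^ i) * (x ^ j * ev y x t) = (ev y x r)⁻¹ * (x ^ (i + j) * ev y x t) := by
    intro x y r t i j hn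
    rcases eq_or_ne r [] with rfl | hr
    · simp
    rcases eq_or_ne t [] with rfl | ht
    · simp
    rcases hn.lt_or_eq with hn | hn
    · exact h.core x y r t i j hn
    · obtain ⟨d, hd, h1⟩ := h1 x y r t hr ht hn
      exact h.core_of_odd x y hr ht hn hd h1 i j
  intro x y r s t i j hn
  rcases eq_or_ne s [] with rfl | hs
  · simpa [link] using hc x y r t i j (by simpa using hn)
  rcases eq_or_ne r [] with rfl | hr
  · have := hc x y s t (-i) (i + j) (by simpa using hn)
    rw [neg_add_cancel_left] at this
    simp only [link, ev_nil, inv_one, one_mul]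
    rw [← this]
    have e : (ev y x s)⁻¹ * x ^ (-i) = (x ^ i * ev y x s)⁻¹ := by simp
    rw [e, mul_inv_cancel_left]
  rcases eq_or_ne t [] with rfl | ht
  · have := hc x y r s (i + j) (-j) (by simpa using hn)
    rw [add_neg_cancel_right] at this
    simp only [link, ev_nil, mul_one]
    rw [← this]
    have e : (ev y x s)⁻¹ * x ^ j = (x ^ (-j) * ev y x s)⁻¹ := by simp
    rw [e, mul_inv_cancel_right]
  exact h.three_legs x y hr hs ht (by omega) i j

end AssocUpTo

theorem assocUpTo_three : AssocUpTo L 3 := by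
  have h0 : AssocUpTo L 0 := fun _ _ _ _ _ _ _ h => by omega
  have ne : ∀ l : List ℤ, l ≠ [] → 0 < l.length := fun l => List.length_pos_iff.2
  refine AssocUpTo.succ (AssocUpTo.succ (AssocUpTo.succ h0 ?_) ?_) ?_
  · intro x y r t hr ht hn; have := ne r hr; omega
  · intro x y r t hr ht hn; have := ne r hr; have := ne t ht; omega
  · intro x y r t hr ht hn
    have := ne r hr
    have := ne t ht
    obtain ⟨a, rfl⟩ := List.length_eq_one_iff.1 (show r.length = 1 by omega)
    obtain ⟨b, rfl⟩ := List.length_eq_one_iff.1 (show t.length = 1 by omega)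
    exact ⟨1, odd_one, by simp [zpow_flex]⟩

end Words

end Loop

/-! ### Associating one letter inside longer words. -/

namespace Loop

section Splitting

variable {L : Type u} [Loop L] [hL : Fact (IsARIF L)] {n : ℕ}

/-- Associating `v = x * y` with a progression `v ^ j * b`, given two consecutive instances. -/
theorem zpow_mul_mul_zpow_mul {x y b : L}
    (h0 : ∀ k : ℤ, (x ^ k * (x * y)) * b = x ^ k * ((x * y) * b))
    (h1 : ∀ k : ℤ, (x ^ k * (x * y)) * ((x * y)⁻¹ * b) = x ^ k * b) (a j : ℤ) :
    x ^ a * (y * ((x * y) ^ j * b)) = (x ^ a * y) * ((x * y) ^ j * b) := by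
  set v := x * y with hv
  have hX := isProgression_zpow_mul v b
  have key : ∀ k j : ℤ, (x ^ k * v) * (v ^ j * b) = x ^ k * (v ^ (j + 1) * b) := by
    intro k j
    -- The consecutive instances `j = 0` and `j = -1` start one parity class each.
    rcases Int.even_or_odd j with ⟨m, hm⟩ | ⟨m, hm⟩
    · have := hX.shift_right (z := x ^ k * v) (w := x ^ k) (i := 0) (j := 1) (by simp [h0]) m
      rw [show 0 + 2 * m = j by linarith, show 1 + 2 * m = j + 1 by linarith] at this
      exact this
    · have := hX.shift_right (z := x ^ k * v) (w := x ^ k) (i := -1) (j := 0)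
        (by simp [h1, -mul_inv_rev]) (m + 1)
      rw [show -1 + 2 * (m + 1) = j by linarith, show 0 + 2 * (m + 1) = j + 1 by linarith] at this
      exact this
  have e1 : y = x ^ (-1 : ℤ) * v := by simp [hv]
  have e2 : x ^ a * y = x ^ (a - 1) * v := by
    rw [hv, zpow_mul_mul, sub_add_cancel]
  rw [e2, key]
  nth_rewrite 1 [e1]
  rw [key, zpow_mul_zpow_mul, sub_eq_add_neg]

theorem AssocUpTo.exists_ev_replicate (h : AssocUpTo L n) (x y : L) (d : ℤ) :
    ∀ m : ℕ, m + 1 ≤ n → ∃ (j : ℤ) (b : L),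
      ev x y (List.replicate m 1 ++ [d]) = (x * y) ^ j * b ∧
      (∀ k : ℤ, (x ^ k * (x * y)) * b = x ^ k * ((x * y) * b)) ∧
      ∀ k : ℤ, (x ^ k * (x * y)) * ((x * y)⁻¹ * b) = x ^ k * b
  | 0, _ => by
    refine ⟨0, x ^ d, by simp, fun k => by rw [zpow_flex], fun k => ?_⟩
    have e : (x * y)⁻¹ * x ^ d = (x ^ k * (x * y))⁻¹ * (x ^ k * x ^ d) := by
      rw [zpow_mul_mul]
      have := mul_zpow_mul_zpow y⁻¹ x (-1) d
      simp only [zpow_neg_one'] at this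
      simp only [mul_inv_rev, inv_zpow, zpow_mul_zpow, mul_zpow_mul_zpow, this]
      congr 2; ring
    rw [e, mul_inv_cancel_left]
  | 1, _ => by
    refine ⟨1, y ^ (d - 1), ?_, fun k => ?_, fun k => ?_⟩
    · simp [mul_mul_zpow]
    · simp only [zpow_mul_mul, mul_mul_zpow]
    · have h2 := zpow_mul_zpow_mul_zpow x y (-1) (-(k + 1)) k (d - 1)
      have h3 := zpow_flex y (x ^ (-1 : ℤ)) (-1) (d - 1)
      rw [show -(k + 1) + k = -1 by ring, h3] at h2
      have e : (x * y)⁻¹ * y ^ (d - 1) = (x ^ k * (x * y))⁻¹ * (x ^ k * y ^ (d - 1)) := by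
        rw [zpow_mul_mul, mul_inv_rev, mul_inv_rev, inv_zpow]
        simpa using h2.symm
      rw [e, mul_inv_cancel_left]
  | m + 2, hm => by
    obtain ⟨j, b, e, h0, h1⟩ := h.exists_ev_replicate x y d m (by omega)
    refine ⟨1 + j, b, ?_, h0, h1⟩
    rw [← mul_zpow_mul', ← e]
    have := h.core_zero y x [-1] (List.replicate m 1 ++ [d]) 1 (by simp; omega)
    simpa [List.replicate_succ] using this.symm

/-- In a word all of whose inner exponents are `1`, the second letter associates. -/
theorem AssocUpTo.ones (h : AssocUpTo L n) (x y : L) (a d : ℤ) (m : ℕ) (hm : m + 1 ≤ n) :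
    x ^ a * (y * ev x y (List.replicate m 1 ++ [d])) =
      (x ^ a * y) * ev x y (List.replicate m 1 ++ [d]) := by
  obtain ⟨j, b, e, h0, h1⟩ := h.exists_ev_replicate x y d m hm
  rw [e]
  exact zpow_mul_mul_zpow_mul h0 h1 a j

/-- Moving a split over two letters. -/
theorem AssocUpTo.shift_two_of_ne_nil (h : AssocUpTo L n) (x y : L) (a b c d : ℤ) {r : List ℤ}
    (hr : r ≠ []) (t : List ℤ) (hn : r.length + t.length + 3 = n) :
    (ev x y (a :: r))⁻¹ * ev y x (b :: c :: d :: t) =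
      (ev x y (-c :: -b :: a :: r))⁻¹ * ev y x (d :: t) := by
  have lr := List.length_pos_iff.2 hr
  set A := (ev x y (a :: r))⁻¹ with hA
  set g := y ^ b * x ^ c with hg
  set w := ev y x (d :: t) with hw
  have e1 : ev y x (b :: c :: d :: t) = g * w := by
    have := h.core_zero x y [-b] (d :: t) c (by simp; omega)
    simpa [hg, hw] using this.symm
  have e2 : (ev x y (-c :: -b :: a :: r))⁻¹ = A * g := by
    have := h.core_zero y x (a :: r) [c] b (by simp; omega)
    simpa [hA, hg] using this
  have e3 : A * g = link x y r (-a) [b, c] := by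
    have := h.core_zero x y r [b, c] (-a) (by simp; omega)
    simpa [hA, hg, link] using this
  have e4 : g⁻¹ * w = x ^ (-c) * ev y x ((-b + d) :: t) := by
    have := h.core y x [c] t (-b) d (by simp; omega)
    simpa [hg, hw] using this
  have e5 : A * (g⁻¹ * w) = link x y r (-a + -c) ((-b + d) :: t) := by
    rw [e4]
    have := h.core x y r ((-b + d) :: t) (-a) (-c) (by simp; omega)
    simpa [hA, link] using this
  have e6 : g⁻¹ * (g⁻¹ * w) = link x y [b, c] (-c) ((-b + d) :: t) := by
    rw [e4]; simp [link, hg]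
  -- In `g⁻¹ * w` the letters `y ^ (-b)` and `y ^ d` merge, which brings this instance within reach
  -- of `three_legs`. The goal is its shift by two along `g ^ k * w`.
  have e7 : A * (g⁻¹ * w) = (A * g) * (g⁻¹ * (g⁻¹ * w)) := by
    rw [e3, e5, e6, h.three_legs x y hr (by simp) (by simp) (by simp; omega)]
  rw [e1, e2]
  have hX := isProgression_zpow_mul g w
  have e8 : g ^ (-2 : ℤ) * w = g⁻¹ * (g⁻¹ * w) := by
    have := zpow_mul_zpow_mul g w (-1) (-1)
    rw [zpow_neg_one'] at this
    exact this.symm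
  have := hX.shift_right (z := A) (w := A * g) (i := -1) (j := -2)
    (by simp only [zpow_neg_one', e8, e7]) 1
  simpa using this

/-- Since `n` is at least four, one of the two outer words has two letters; if it is the right one,
inversion reverses the roles. -/
theorem AssocUpTo.shift_two (h : AssocUpTo L n) (h4 : 4 ≤ n) (x y : L) (b c : ℤ) {l t : List ℤ}
    (hl : l ≠ []) (ht : t ≠ []) (hn : l.length + t.length + 1 = n) :
    (ev x y l)⁻¹ * ev y x (b :: c :: t) = (ev x y (-c :: -b :: l))⁻¹ * ev y x t := by
  obtain ⟨a, r, rfl⟩ := List.exists_cons_of_ne_nil hl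
  obtain ⟨d, t, rfl⟩ := List.exists_cons_of_ne_nil ht
  simp only [List.length_cons] at hn
  rcases eq_or_ne r [] with rfl | hr
  · have ht' : t ≠ [] := by rintro rfl; simp at hn; omega
    have := h.shift_two_of_ne_nil y x d (-c) (-b) a ht' [] (by simp at hn ⊢; omega)
    apply inv_injective
    simp only [neg_neg] at this
    rw [mul_inv_rev, mul_inv_rev, inv_inv, inv_inv]
    exact this.symm
  · exact h.shift_two_of_ne_nil x y a b c d hr t (by omega)

/-- The split moves left until one letter remains there, where `ones` applies. At each step the
inductive case has exponent `1`, `core_of_odd` frees that exponent, and `shift_two` carries the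
split back. -/
theorem AssocUpTo.split_ones (h : AssocUpTo L n) (h4 : 4 ≤ n) :
    ∀ (l : List ℤ) (x y : L) (m : ℕ) (d : ℤ), l ≠ [] → l.length + m + 1 = n →
      (ev x y l)⁻¹ * (y * ev x y (List.replicate m 1 ++ [d])) =
        ((ev x y l)⁻¹ * y) * ev x y (List.replicate m 1 ++ [d])
  | [], _, _, _, _, hl, _ => absurd rfl hl
  | [a], x, y, m, d, _, hn => by
    simpa using h.ones x y (-a) d m (by simp at hn; omega)
  | c :: a :: l, x, y, m, d, _, hn => by
    simp only [List.length_cons] at hn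
    have ih := h.split_ones h4 (a :: l) y x (m + 1) d (by simp) (by simp; omega)
    have e1 := h.core_of_odd x y (r := a :: l) (t := List.replicate (m + 1) 1 ++ [d]) (by simp)
      (by simp) (by simp; omega) odd_one (by simpa using ih) (-c) 0
    have e2 := h.shift_two h4 y x (-c) 1 (l := a :: l) (t := List.replicate m 1 ++ [d]) (by simp)
      (by simp) (by simp; omega)
    simp [List.replicate_succ] at e1 e2 ⊢
    rw [e1, e2]

/-- The same movement to the right, ending at a single letter, which is `split_ones` with `m = 0`.
-/
theorem AssocUpTo.split (h : AssocUpTo L n) (h4 : 4 ≤ n) :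
    ∀ (t l : List ℤ) (x y : L), t ≠ [] → l ≠ [] → l.length + t.length = n →
      (ev x y l)⁻¹ * (y * ev x y t) = ((ev x y l)⁻¹ * y) * ev x y t
  | [], _, _, _, ht, _, _ => absurd rfl ht
  | [d], l, x, y, _, hl, hn => by
    simpa using h.split_ones h4 l x y 0 d hl (by simpa using hn)
  | d :: e :: t, l, x, y, _, hl, hn => by
    simp only [List.length_cons] at hn
    have ih := h.split h4 (e :: t) (-1 :: l) y x (by simp) (by simp) (by simp; omega)
    have e1 := h.core_of_odd x y (r := -1 :: l) (t := e :: t) (by simp) (by simp)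
      (by simp; omega) odd_one (by simpa using ih) d 0
    have e2 := h.shift_two h4 x y 1 d (l := l) (t := e :: t) hl (by simp) (by simp; omega)
    simp at e1 e2 ⊢
    rw [e2, e1]

end Splitting

end Loop

/-! ### Four letters, the full induction, and the subloop of words. -/

namespace Loop

section Diassociative

variable {L : Type u} [Loop L] [hL : Fact (IsARIF L)]

/-- Along `g ^ k * y ^ d` the claim is a shift by two of `e5`. That instance amounts to transferring
`x ^ a` across a product, which progressions permit for even `a`. -/
theorem zpow_mul_four_of_even (x y : L) {a : ℤ} (ha : Even a) (b c d : ℤ) :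
    x ^ a * ((y ^ b * x ^ c) * y ^ d) = (x ^ a * (y ^ b * x ^ c)) * y ^ d := by
  set g := y ^ b * x ^ c with hg
  obtain ⟨m, hm⟩ := ha
  have hX := isProgression_zpow_mul g (y ^ d)
  have e1 : g⁻¹ * y ^ d = x ^ (-c) * y ^ (-b + d) := by simp [hg]
  have e2 : g ^ (-2 : ℤ) * y ^ d = g⁻¹ * (x ^ (-c) * y ^ (-b + d)) := by
    have := zpow_mul_zpow_mul g (y ^ d) (-1) (-1)
    rw [zpow_neg_one', e1] at this
    exact this.symm
  have h0 : ∀ p : ℤ, ((x ^ (-c) * y ^ (-b)) * x ^ (-p)) * (x ^ p * y ^ (-b + d)) =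
      (x ^ (-c) * y ^ (-b)) * y ^ (-b + d) := by
    intro p
    have := (assocUpTo_three (L := L)) y x [c] [-p] [] (-b) (-b + d) (by simp)
    simpa [link, zpow_flex] using this
  have e3 := mul_zpow_mul_zpow_mul_even h0 0 (-c) (-m)
  rw [show 0 + 2 * -m = -a by linarith, show -c - 2 * -m = a + -c by linarith] at e3
  have e4 : ((x ^ (-c) * y ^ (-b)) * x ^ (-a)) = (x ^ a * g)⁻¹ := by simp [hg]
  have e5 : x ^ a * (g⁻¹ * y ^ d) = (x ^ a * g) * (g ^ (-2 : ℤ) * y ^ d) := by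
    have e6 : g⁻¹ = x ^ (-c) * y ^ (-b) := by simp [hg]
    rw [e4, zpow_zero, mul_one, ← e6] at e3
    rw [e2, e3, e1, mul_inv_cancel_left, zpow_mul_zpow_mul]
  have := hX.shift_right (z := x ^ a) (w := x ^ a * g) (i := -1) (j := -2)
    (by simp only [zpow_neg_one', e5]) 1
  simpa using this

theorem exists_odd_zpow_mul_four (x y : L) (a c d : ℤ) : ∃ b : ℤ, Odd b ∧
    x ^ a * (y ^ b * (x ^ c * y ^ d)) = (x ^ a * y ^ b) * (x ^ c * y ^ d) := by
  rcases Int.even_or_odd d with hd | hd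
  -- The even case, inverted, splits off `y ^ d`. Regrouping the rest needs only one odd power of
  -- `x`, and for `x⁻¹` the inverted equation is an instance of `ones`.
  · refine ⟨-1, by decide, ?_⟩
    have h1 : x ^ a * (y ^ (-1 : ℤ) * (x ^ c * y ^ d)) =
        (x ^ a * (y ^ (-1 : ℤ) * x ^ c)) * y ^ d := by
      apply inv_injective
      have e1 := zpow_mul_four_of_even y x hd.neg (-c) 1 (-a)
      have e2 := zpow_flex y (x ^ (-c)) (-d) 1
      simp only [zpow_one] at e1 e2
      simp [e1, ← e2]
    have h2 : (x ^ a * y⁻¹) * (x⁻¹ * y ^ d) = ((x ^ a * y⁻¹) * x⁻¹) * y ^ d := by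
      apply inv_injective
      simpa using ((assocUpTo_three (L := L)).ones y x (-d) (-a) 1 (by norm_num)).symm
    have h3 := (assocUpTo_three (L := L)).core_of_odd x y (r := [1, -a]) (t := [d]) (by simp)
      (by simp) (by simp) (d := -1) (by decide) (by simpa using h2) c 0
    rw [h1, zpow_flex]
    simpa using h3
  -- With `b = d`, `y ^ b` is `x ^ (-c) * v`, so both sides become `x ^ (a - c) * v ^ 2`.
  · refine ⟨d, hd, ?_⟩
    set v := x ^ c * y ^ d with hv
    have e1 : y ^ d = x ^ (-c) * v := by simp [hv]
    have e2 : x ^ a * y ^ d = x ^ (a + -c) * v := by rw [hv, zpow_mul_zpow_mul]; congr 2; ring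
    have e3 : ∀ z : L, (z * v) * v = z * v ^ (2 : ℤ) := fun z => by
      simpa using mul_zpow_mul_zpow z v 1 1
    rw [e2, e3]
    nth_rewrite 1 [e1]
    rw [e3, zpow_mul_zpow_mul]

theorem assocUpTo_four : AssocUpTo L 4 := by
  refine (assocUpTo_three (L := L)).succ ?_
  have one_two : ∀ (x y : L) (r t : List ℤ), r.length = 1 → t.length = 2 → ∃ d : ℤ, Odd d ∧
      (ev y x r)⁻¹ * (x ^ d * ev y x t) = ((ev y x r)⁻¹ * x ^ d) * ev y x t := by
    intro x y r t hr ht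
    obtain ⟨a, rfl⟩ := List.length_eq_one_iff.1 hr
    obtain ⟨b, c, rfl⟩ := List.length_eq_two.1 ht
    simpa using exists_odd_zpow_mul_four y x (-a) b c
  intro x y r t hr ht hn
  have l1 := List.length_pos_iff.2 hr
  have l2 := List.length_pos_iff.2 ht
  rcases (show r.length = 1 ∨ r.length = 2 by omega) with hr | hr
  · exact one_two x y r t hr (by omega)
  · obtain ⟨d, hd, h⟩ := one_two x y t r (by omega) hr
    refine ⟨-d, hd.neg, ?_⟩
    apply inv_injective
    simpa using h.symm

theorem assocUpTo (n : ℕ) : AssocUpTo L n := by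
  induction n with
  | zero => exact fun _ _ _ _ _ _ _ h => by omega
  | succ n ih =>
    rcases Nat.lt_or_ge n 4 with hn | hn
    · intro x y r s t i j h
      exact assocUpTo_four x y r s t i j (by omega)
    · refine ih.succ fun x y r t hr ht hl => ⟨1, odd_one, ?_⟩
      simpa using ih.split hn t r y x ht hr hl

/-- Products along words compose. -/
theorem inv_ev_mul_ev_trans (x y : L) (r s t : List ℤ) :
    ((ev x y r)⁻¹ * ev x y s) * ((ev x y s)⁻¹ * ev x y t) = (ev x y r)⁻¹ * ev x y t := by
  simpa [link] using assocUpTo _ y x r s t 0 0 le_rfl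

/-- This puts any word in the form `p⁻¹ p'` for a prescribed `p`, as needed to apply
`inv_ev_mul_ev_trans`; `p'` plays the part of the product `p q`. -/
theorem exists_inv_ev_mul_ev (x y : L) (q : List ℤ) :
    ∀ p : List ℤ, ∃ p', (ev x y p)⁻¹ * ev x y p' = ev x y q := by
  intro p
  induction p generalizing x y q with
  | nil => exact ⟨q, by simp⟩
  | cons a p ih =>
    obtain ⟨p', hp'⟩ := ih y x (0 :: q)
    refine ⟨a :: p', ?_⟩
    rw [show ev x y q = ev y x (0 :: q) by simp, ← hp']
    have := (assocUpTo (L := L) _).core x y p p' (-a) a le_rfl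
    simpa using this

theorem mul_mem_range_ev {x y a b : L} (ha : a ∈ Set.range (ev x y))
    (hb : b ∈ Set.range (ev x y)) : a * b ∈ Set.range (ev x y) := by
  obtain ⟨p, rfl⟩ := ha
  obtain ⟨q, rfl⟩ := hb
  obtain ⟨p', hp'⟩ := exists_inv_ev_mul_ev x y q p
  exact ⟨p', by rw [← hp', mul_inv_cancel_left]⟩

theorem inv_ev_mem_range_ev (x y : L) (p : List ℤ) : (ev x y p)⁻¹ ∈ Set.range (ev x y) := by
  induction p generalizing x y with
  | nil => exact ⟨[], by simp⟩
  | cons a p ih =>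
    obtain ⟨q, hq⟩ := ih y x
    rw [ev_cons, mul_inv_rev]
    exact mul_mem_range_ev ⟨0 :: q, by simp [hq]⟩ ⟨[-a], by simp⟩

theorem inv_mem_range_ev {x y a : L} (ha : a ∈ Set.range (ev x y)) :
    a⁻¹ ∈ Set.range (ev x y) := by
  obtain ⟨p, rfl⟩ := ha
  exact inv_ev_mem_range_ev x y p

/-- The words in `x` and `y` form a subloop. -/
def wordSubloop (x y : L) : Subloop L where
  carrier := Set.range (ev x y)
  one_mem := ⟨[], rfl⟩
  mul_mem := mul_mem_range_ev
  ldiv_mem ha hb := by rw [ldiv_eq]; exact mul_mem_range_ev (inv_mem_range_ev ha) hb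
  rdiv_mem ha hb := by rw [rdiv_eq]; exact mul_mem_range_ev ha (inv_mem_range_ev hb)

theorem closure_pair_subset (x y : L) :
    (Subloop.closure ({x, y} : Set L)).carrier ⊆ Set.range (ev x y) := by
  intro a ha
  refine ha (wordSubloop x y) ?_
  rintro _ (rfl | rfl)
  · exact ⟨[1], by simp⟩
  · exact ⟨[0, 1], by simp⟩

theorem mul_assoc_of_mem_range_ev {x y a b c : L} (ha : a ∈ Set.range (ev x y))
    (hb : b ∈ Set.range (ev x y)) (hc : c ∈ Set.range (ev x y)) : (a * b) * c = a * (b * c) := by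
  obtain ⟨p, hp⟩ := inv_mem_range_ev ha
  obtain ⟨q, rfl⟩ := hb
  obtain ⟨r, rfl⟩ := hc
  obtain ⟨r', hr'⟩ := exists_inv_ev_mul_ev x y r q
  rw [← inv_inv a, ← hp, ← hr', inv_ev_mul_ev_trans, mul_inv_cancel_left]

end Diassociative

end Loop

theorem theorem1p4 {L : Type u} [Loop L] (hL : Loop.IsARIF L) :
    Loop.IsDiassociative L := by
  intro x y
  have : Fact (Loop.IsARIF L) := ⟨hL⟩
  have hsub := Loop.closure_pair_subset x y
  exact ⟨Group.ofLeftAxioms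
    (fun a b c => Subtype.ext (Loop.mul_assoc_of_mem_range_ev (hsub a.2) (hsub b.2) (hsub c.2)))
    one_mul (fun a => Subtype.ext (Loop.inv_mul_self a.1)), rfl⟩
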